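/- Let $n \ge 0$ and write $\langle p,x\rangle=\sum_{i=1}^n p_i x_i$. For a function $h$ with values in $\mathbb{R}\cup\{-\infty,+\infty\}$ let $\operatorname{dom} h=\{x : -\infty<h(x)<+\infty\}$. For $x\in\mathbb{R}^n$ let $N(x)=\{z\in\mathbb{Z}^n : |x_i-z_i|<1\ (i=1,\dots,n)\}$. A function $f:\mathbb{Z}^n\to\mathbb{R}\cup\{+\infty\}$ is called integrally convex if its local convex extension $$\tilde f(x)=\min\Big\{\sum_{y\in N(x)}\lambda_y f(y) \;:\; \sum_{y\in N(x)}\lambda_y y=x,\ \sum_{y\in N(x)}\lambda_y=1,\ \lambda_y\ge 0\ (y\in N(x))\Big\}\qquad(x\in\mathbb{R}^n)$$ (with $0\cdot(+\infty)=0$) is a convex function $\mathbb{R}^n\to\mathbb{R}\cup\{+\infty\}$. An integer-valued function $\Psi:\mathbb{Z}^n\to\mathbb{Z}\cup\{-\infty\}$ is called separable concave if $\Psi(x)=\psi_1(x_1)+\cdots+\psi_n(x_n)$ for functions $\psi_i:\mathbb{Z}\to\mathbb{Z}\cup\{-\infty\}$ such that $\operatorname{dom}\psi_i$ is an interval of integers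 and $\psi_i(k-1)+\psi_i(k+1)\le 2\psi_i(k)$ for all $k\in\mathbb{Z}$. **Theorem (Main result).** Let $f:\mathbb{Z}^n\to\mathbb{Z}\cup\{+\infty\}$ be an integer-valued integrally convex function with $\operatorname{dom} f\neq\emptyset$, and let $\Psi:\mathbb{Z}^n\to\mathbb{Z}\cup\{-\infty\}$ be an integer-valued separable concave function with $\operatorname{dom}\Psi\ne\emptyset$. For $p\in\mathbb{Z}^n$ define the integral conjugates $$f^{\bullet}(p)=\sup\{\langle p,x\rangle-f(x) : x\in\mathbb{Z}^n\}\in\mathbb{Z}\cup\{+\infty\},\qquad \Psi^{\circ}(p)=\inf\{\langle p,x\rangle-\Psi(x) : x\in\mathbb{Z}^n\}\in\mathbb{Z}\cup\{-\infty\}.$$ If at least one of $$\inf\{f(x)-\Psi(x) : x\in\mathbb{Z}^n\},\qquad \sup\{\Psi^{\circ}(p)-f^{\bullet}(p) : p\in\mathbb{Z}^n\}$$ is finite, then both are finite, both are attained, and $$\min\{f(x)-\Psi(x) : x\in\mathbb{Z}^n\}=\max\{\Psi^{\circ}(p)-f^{\bullet}(p) : p\in\mathbb{Z}^n\}.$$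 -/

import Mathlib

noncomputable section

namespace DiscConv

/-- `h` takes values in `ℤ ∪ {+∞}`. -/
def IntOrTop {α : Type*} (h : α → EReal) : Prop :=
  ∀ x, h x = ⊤ ∨ ∃ k : ℤ, h x = ((k : ℝ) : EReal)

/-- `h` takes values in `ℤ ∪ {-∞}`. -/
def IntOrBot {α : Type*} (h : α → EReal) : Prop :=
  ∀ x, h x = ⊥ ∨ ∃ k : ℤ, h x = ((k : ℝ) : EReal)

/-- The effective domain `{x | -∞ < h x < +∞}`. -/
def effDom {α : Type*} (h : α → EReal) : Set α :=
  {x | ⊥ < h x ∧ h x < ⊤}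

/-- The integral neighborhood `N(x) = {z ∈ ℤⁿ | ⌊xᵢ⌋ ≤ zᵢ ≤ ⌈xᵢ⌉ for all i}` of `x ∈ ℝⁿ`. -/
def intNbhd {n : ℕ} (x : Fin n → ℝ) : Finset (Fin n → ℤ) :=
  Fintype.piFinset fun i => Finset.Icc ⌊x i⌋ ⌈x i⌉

theorem mem_intNbhd {n : ℕ} (x : Fin n → ℝ) (z : Fin n → ℤ) :
    z ∈ intNbhd x ↔ ∀ i, |x i - z i| < 1 := by
  simp only [intNbhd, Fintype.mem_piFinset, Finset.mem_Icc]
  refine forall_congr' fun i => ?_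
  rw [abs_lt, ← Int.lt_add_one_iff, Int.floor_lt, ← Int.sub_one_lt_iff, Int.lt_ceil]
  push_cast
  constructor <;> rintro ⟨h1, h2⟩ <;> constructor <;> linarith

/-- The coefficient vectors `(c_y)_{y ∈ N(x)}` of the representations of `x` as a convex
combination of the points of `N(x)`. Values of `c` outside `N(x)` play no role. -/
def convCoeffs {n : ℕ} (x : Fin n → ℝ) : Set ((Fin n → ℤ) → ℝ) :=
  {c | (∀ y ∈ intNbhd x, 0 ≤ c y) ∧ ∑ y ∈ intNbhd x, c y = 1 ∧
    ∀ i, ∑ y ∈ intNbhd x, c y * (y i : ℝ) = x i}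

/-- The local convex extension of `f : ℤⁿ → ℝ ∪ {+∞}`; here `0 * ⊤ = 0`. -/
def localConvexExt {n : ℕ} (f : (Fin n → ℤ) → EReal) (x : Fin n → ℝ) : EReal :=
  ⨅ c ∈ convCoeffs x, ∑ y ∈ intNbhd x, (c y : EReal) * f y

/-- Convexity of a function `g : ℝⁿ → ℝ ∪ {+∞}`. -/
def ExtConvex {n : ℕ} (g : (Fin n → ℝ) → EReal) : Prop :=
  ∀ (x y : Fin n → ℝ) (a b : ℝ), 0 ≤ a → 0 ≤ b → a + b = 1 →
    g (a • x + b • y) ≤ (a : EReal) * g x + (b : EReal) * g y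

/-- `f : ℤⁿ → ℝ ∪ {+∞}` is integrally convex: its local convex extension is convex on `ℝⁿ`. -/
def IntegrallyConvex {n : ℕ} (f : (Fin n → ℤ) → EReal) : Prop :=
  ExtConvex (localConvexExt f)

/-- `ψ : ℤ → ℝ ∪ {-∞}` is a univariate discrete concave function. -/
def DiscreteConcave (ψ : ℤ → EReal) : Prop :=
  (effDom ψ).OrdConnected ∧ ∀ k : ℤ, ψ (k - 1) + ψ (k + 1) ≤ 2 * ψ k

/-- `Ψ : ℤⁿ → ℤ ∪ {-∞}` is an integer-valued separable concave function. -/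
def IntSeparableConcave {n : ℕ} (Ψ : (Fin n → ℤ) → EReal) : Prop :=
  ∃ ψ : Fin n → ℤ → EReal, (∀ i, IntOrBot (ψ i)) ∧ (∀ i, DiscreteConcave (ψ i)) ∧
    ∀ x, Ψ x = ∑ i, ψ i (x i)

/-- The inner product `⟨p, x⟩` of integer vectors. -/
def pairing {n : ℕ} (p x : Fin n → ℤ) : ℤ := ∑ i, p i * x i

/-- The integral convex conjugate `f•(p) = sup {⟨p, x⟩ - f x | x ∈ ℤⁿ}` for `p ∈ ℤⁿ`. -/
def convexConj {n : ℕ} (f : (Fin n → ℤ) → EReal) (p : Fin n → ℤ) : EReal :=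
  ⨆ x : Fin n → ℤ, (((pairing p x : ℤ) : ℝ) : EReal) - f x

/-- The integral concave conjugate `g°(p) = inf {⟨p, x⟩ - g x | x ∈ ℤⁿ}` for `p ∈ ℤⁿ`. -/
def concaveConj {n : ℕ} (g : (Fin n → ℤ) → EReal) (p : Fin n → ℤ) : EReal :=
  ⨅ x : Fin n → ℤ, (((pairing p x : ℤ) : ℝ) : EReal) - g x

/-- An extended real number is finite. -/
def IsFin (a : EReal) : Prop := a ≠ ⊥ ∧ a ≠ ⊤

end DiscConv

end

namespace DiscConv

/-! Weak duality is immediate, and integer values that are bounded below attain their minimum.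
Strong duality thus amounts to an integer `p` that is both a subgradient of `f` and a supergradient
of `Ψ` at a minimizer `x₀` (`exists_common_subgradient`).

The supergradients of a separable `Ψ` contain a product of integer intervals. Optimality against `x₀
+ d`, `d ∈ {-1,0,1}ⁿ`, yields a `p` in this product suited to that single `d`. One `p` for all `d`
comes from `IntegrallyConvex.exists_subgradient_mem_box`: coordinates are fixed one at a time, as in
Fourier–Motzkin elimination. Integral convexity at a midpoint makes the lower and upper bounds
compatible, and the bounds are integers. By `IntegrallyConvex.subgradient_of_local`, testing unit
directions suffices.

If only the dual value is known to be finite, the effective domains must meet: otherwise, replacing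
`Ψ` by a linear function with a steep penalty for leaving `dom Ψ` produces arbitrarily large dual
values (`exists_dual_ge`). -/

theorem coe_sum_real {ι : Type*} (s : Finset ι) (g : ι → ℝ) :
    ((∑ i ∈ s, g i : ℝ) : EReal) = ∑ i ∈ s, (g i : EReal) := by
  classical
  induction s using Finset.induction_on with
  | empty => simp
  | insert a s ha ih => rw [Finset.sum_insert ha, Finset.sum_insert ha, EReal.coe_add, ih]

/-! ### Affine minorants and local subgradients -/

section ConvexExtension

variable {n : ℕ}

theorem le_localConvexExt {f : (Fin n → ℤ) → EReal} {x : Fin n → ℝ} {φ : (Fin n → ℤ) → ℝ}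
    {r : ℝ} (hφ : ∀ y ∈ intNbhd x, (φ y : EReal) ≤ f y)
    (hr : ∀ c ∈ convCoeffs x, r ≤ ∑ y ∈ intNbhd x, c y * φ y) :
    (r : EReal) ≤ localConvexExt f x := by
  refine le_iInf₂ fun c hc => ?_
  calc (r : EReal) ≤ ((∑ y ∈ intNbhd x, c y * φ y : ℝ) : EReal) := EReal.coe_le_coe_iff.2 (hr c hc)
    _ = ∑ y ∈ intNbhd x, (c y : EReal) * (φ y : EReal) := by
        rw [coe_sum_real]; simp only [EReal.coe_mul]
    _ ≤ ∑ y ∈ intNbhd x, (c y : EReal) * f y :=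
        Finset.sum_le_sum fun y hy =>
          mul_le_mul_of_nonneg_left (hφ y hy) (EReal.coe_nonneg.2 (hc.1 y hy))

theorem localConvexExt_intCast_le (f : (Fin n → ℤ) → EReal) (z : Fin n → ℤ) :
    localConvexExt f (fun i => (z i : ℝ)) ≤ f z := by
  have hN : intNbhd (fun i => (z i : ℝ)) = {z} := by
    ext y
    simp only [intNbhd, Fintype.mem_piFinset, Int.floor_intCast, Int.ceil_intCast,
      Finset.Icc_self, Finset.mem_singleton, funext_iff]
  refine (iInf₂_le (fun _ => (1 : ℝ)) ⟨?_, ?_, ?_⟩).trans ?_ <;> simp [hN]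

theorem sum_convCoeffs_affine {x : Fin n → ℝ} {c : (Fin n → ℤ) → ℝ} (hc : c ∈ convCoeffs x)
    (k : ℝ) (α z : Fin n → ℝ) :
    ∑ y ∈ intNbhd x, c y * (k + ∑ j, α j * ((y j : ℝ) - z j)) = k + ∑ j, α j * (x j - z j) := by
  have h1 : ∀ y ∈ intNbhd x, c y * (k + ∑ j, α j * ((y j : ℝ) - z j)) =
      c y * k + ∑ j, (α j * (c y * (y j : ℝ)) - α j * z j * c y) := by
    intro y _
    rw [mul_add, Finset.mul_sum]
    congr 1
    exact Finset.sum_congr rfl fun j _ => by ring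
  rw [Finset.sum_congr rfl h1, Finset.sum_add_distrib, ← Finset.sum_mul, hc.2.1, one_mul,
    Finset.sum_comm]
  congr 1
  refine Finset.sum_congr rfl fun j _ => ?_
  rw [Finset.sum_sub_distrib, ← Finset.mul_sum, ← Finset.mul_sum, hc.2.2 j, hc.2.1]
  ring

/-- An affine minorant of `f` on the integral neighborhood of a point of a segment between two
integer points lies below the chord of `f`. -/
theorem IntegrallyConvex.affine_le_chord {f : (Fin n → ℤ) → EReal} (hf : IntegrallyConvex f)
    {u v : Fin n → ℤ} {s t : ℝ} (hu : f u = (s : EReal)) (hv : f v = (t : EReal))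
    {ε : ℝ} (h0 : 0 ≤ ε) (h1 : ε ≤ 1) {k : ℝ} {α z : Fin n → ℝ}
    (h : ∀ y ∈ intNbhd (fun j => (1 - ε) * (u j : ℝ) + ε * (v j : ℝ)),
      ((k + ∑ j, α j * ((y j : ℝ) - z j) : ℝ) : EReal) ≤ f y) :
    k + ∑ j, α j * ((1 - ε) * (u j : ℝ) + ε * (v j : ℝ) - z j) ≤ (1 - ε) * s + ε * t := by
  have hc := hf (fun j => (u j : ℝ)) (fun j => (v j : ℝ)) (1 - ε) ε (by linarith) h0 (by ring)
  have hx : ((1 - ε) • (fun j => (u j : ℝ)) + ε • (fun j => (v j : ℝ)) : Fin n → ℝ) =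
      fun j => (1 - ε) * (u j : ℝ) + ε * (v j : ℝ) := by
    ext j; simp
  rw [hx] at hc
  have hlow := le_localConvexExt h fun c hc => (sum_convCoeffs_affine hc k α z).ge
  have hup : ((1 - ε : ℝ) : EReal) * localConvexExt f (fun j => (u j : ℝ)) +
      (ε : EReal) * localConvexExt f (fun j => (v j : ℝ)) ≤ (((1 - ε) * s + ε * t : ℝ) : EReal) := by
    rw [EReal.coe_add, EReal.coe_mul, EReal.coe_mul, ← hu, ← hv]
    exact add_le_add
      (mul_le_mul_of_nonneg_left (localConvexExt_intCast_le f u)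
        (EReal.coe_nonneg.2 (by linarith)))
      (mul_le_mul_of_nonneg_left (localConvexExt_intCast_le f v) (EReal.coe_nonneg.2 h0))
  exact EReal.coe_le_coe_iff.1 (hlow.trans (hc.trans hup))

/-- A local subgradient of an integrally convex function is a global one. -/
theorem IntegrallyConvex.subgradient_of_local {f : (Fin n → ℤ) → EReal} (hf : IntegrallyConvex f)
    (hi : IntOrTop f) {x₀ : Fin n → ℤ} {k₀ : ℤ} (hx₀ : f x₀ = ((k₀ : ℝ) : EReal)) {p : Fin n → ℤ}
    (hp : ∀ y : Fin n → ℤ, (∀ j, |y j - x₀ j| ≤ 1) → ∀ m : ℤ, f y = ((m : ℝ) : EReal) →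
      k₀ + ∑ j, p j * (y j - x₀ j) ≤ m)
    (y : Fin n → ℤ) (m : ℤ) (hm : f y = ((m : ℝ) : EReal)) :
    k₀ + ∑ j, p j * (y j - x₀ j) ≤ m := by
  -- The point `x₀ + (y - x₀) / D` differs from `x₀` by less than 1 in each coordinate, so its
  -- integral neighborhood lies in `x₀ + {-1,0,1}ⁿ`, where `hp` applies.
  set D : ℝ := 1 + ∑ j, |(y j : ℝ) - x₀ j| with hD
  have hD1 : 1 ≤ D := by
    have : 0 ≤ ∑ j, |(y j : ℝ) - x₀ j| := Finset.sum_nonneg fun j _ => abs_nonneg _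
    linarith
  have hDpos : 0 < D := by linarith
  have hεpos : 0 < D⁻¹ := inv_pos.2 hDpos
  have hε1 : D⁻¹ ≤ 1 := inv_le_one_of_one_le₀ hD1
  have key := hf.affine_le_chord (k := k₀) (α := fun j => (p j : ℝ)) (z := fun j => (x₀ j : ℝ))
    hx₀ hm hεpos.le hε1 ?_
  · have hsum : ∑ j, (p j : ℝ) * ((1 - D⁻¹) * (x₀ j : ℝ) + D⁻¹ * (y j : ℝ) - x₀ j) =
        D⁻¹ * ∑ j, (p j : ℝ) * ((y j : ℝ) - x₀ j) := by
      rw [Finset.mul_sum]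
      exact Finset.sum_congr rfl fun j _ => by ring
    rw [hsum] at key
    have h2 : D⁻¹ * ((k₀ : ℝ) + ∑ j, (p j : ℝ) * ((y j : ℝ) - x₀ j)) ≤ D⁻¹ * m := by linarith
    have h3 := le_of_mul_le_mul_left h2 hεpos
    exact_mod_cast h3
  · intro w hw
    rw [mem_intNbhd] at hw
    rcases hi w with h | ⟨l, hl⟩
    · rw [h]; exact le_top
    · rw [hl, EReal.coe_le_coe_iff]
      have := hp w (fun j => ?_) l hl
      · exact_mod_cast this
      · have hj : |(y j : ℝ) - x₀ j| < D := by
          have := Finset.single_le_sum (f := fun j => |(y j : ℝ) - x₀ j|)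
            (fun j _ => abs_nonneg _) (Finset.mem_univ j)
          linarith
        have h2 : |D⁻¹ * ((y j : ℝ) - x₀ j)| < 1 := by
          rw [abs_mul, abs_of_pos hεpos, inv_mul_lt_iff₀ hDpos]
          linarith
        have h3 := hw j
        rw [abs_lt] at h2 h3
        have h4 : ((w j - x₀ j : ℤ) : ℝ) < 2 := by push_cast; linarith
        have h5 : (-2 : ℝ) < ((w j - x₀ j : ℤ) : ℝ) := by push_cast; linarith
        have h4' : w j - x₀ j < 2 := by exact_mod_cast h4
        have h5' : -2 < w j - x₀ j := by exact_mod_cast h5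
        rw [abs_le]; omega

end ConvexExtension

/-! ### Integer subgradients in a box -/

section BoxIntegrality

variable {n : ℕ}

/-- The cross inequality at a pair of opposite directions `d i = 1`, `e i = -1`. -/
theorem IntegrallyConvex.cross_inequality {f : (Fin n → ℤ) → EReal} (hf : IntegrallyConvex f)
    (hi : IntOrTop f) {x₀ : Fin n → ℤ} {k₀ : ℤ} {a b : Fin n → ℤ} (hab : ∀ j, a j ≤ b j)
    (h : ∀ d : Fin n → ℤ, (∀ j, |d j| ≤ 1) → ∀ m : ℤ, f (x₀ + d) = ((m : ℝ) : EReal) →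
      k₀ + ∑ j, min (a j * d j) (b j * d j) ≤ m)
    {i : Fin n} {d e : Fin n → ℤ} (hd : ∀ j, |d j| ≤ 1) (he : ∀ j, |e j| ≤ 1)
    (hdi : d i = 1) (hei : e i = -1) {m l : ℤ} (hm : f (x₀ + d) = ((m : ℝ) : EReal))
    (hl : f (x₀ + e) = ((l : ℝ) : EReal)) :
    2 * k₀ + ∑ j ∈ Finset.univ.erase i, min (a j * d j) (b j * d j) +
      ∑ j ∈ Finset.univ.erase i, min (a j * e j) (b j * e j) ≤ m + l := by
  -- Near the midpoint of `x₀ + d` and `x₀ + e`, the sign of `w j - x₀ j` never opposes that of `d j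
  -- + e j`. The minima in `h` are therefore linear there, with slopes `α`; coordinate `i` drops out
  -- because `d i + e i = 0`.
  set α : Fin n → ℤ := fun j => if 0 ≤ d j + e j then a j else b j with hα
  have key := hf.affine_le_chord (k := k₀) (α := fun j => (α j : ℝ)) (z := fun j => (x₀ j : ℝ))
    hm hl (ε := 1 / 2) (by norm_num) (by norm_num) ?_
  · have hsum : ∑ j, (α j : ℝ) * ((1 - 1 / 2) * (((x₀ + d) j : ℤ) : ℝ) +
        1 / 2 * (((x₀ + e) j : ℤ) : ℝ) - x₀ j) = 1 / 2 * ((∑ j, α j * (d j + e j) : ℤ) : ℝ) := by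
      push_cast
      rw [Finset.mul_sum]
      exact Finset.sum_congr rfl fun j _ => by simp only [Pi.add_apply]; push_cast; ring
    rw [hsum] at key
    have h2 : 2 * (k₀ : ℝ) + ((∑ j, α j * (d j + e j) : ℤ) : ℝ) ≤ m + l := by linarith
    have h3 : 2 * k₀ + ∑ j, α j * (d j + e j) ≤ m + l := by exact_mod_cast h2
    rw [← Finset.sum_erase_add _ _ (Finset.mem_univ i), hdi, hei] at h3
    have h4 : ∑ j ∈ Finset.univ.erase i, min (a j * d j) (b j * d j) +
        ∑ j ∈ Finset.univ.erase i, min (a j * e j) (b j * e j) ≤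
        ∑ j ∈ Finset.univ.erase i, α j * (d j + e j) := by
      rw [← Finset.sum_add_distrib]
      refine Finset.sum_le_sum fun j _ => ?_
      rw [mul_add]
      by_cases hs : 0 ≤ d j + e j
      · simp only [hα, if_pos hs]
        exact add_le_add (min_le_left _ _) (min_le_left _ _)
      · simp only [hα, if_neg hs]
        exact add_le_add (min_le_right _ _) (min_le_right _ _)
    linarith
  · intro w hw
    rw [mem_intNbhd] at hw
    rcases hi w with hw' | ⟨q, hq⟩
    · rw [hw']; exact le_top
    rw [hq, EReal.coe_le_coe_iff]
    have hbd : ∀ j, 2 * (w j - x₀ j) - (d j + e j) < 2 ∧ -2 < 2 * (w j - x₀ j) - (d j + e j) := by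
      intro j
      have h3 := hw j
      rw [abs_lt] at h3
      simp only [Pi.add_apply] at h3
      push_cast at h3
      constructor
      · have : (2 * ((w j : ℝ) - x₀ j) - (d j + e j)) < 2 := by linarith
        exact_mod_cast this
      · have : -2 < (2 * ((w j : ℝ) - x₀ j) - (d j + e j)) := by linarith
        exact_mod_cast this
    have := h (w - x₀) (fun j => ?_) q (by rw [add_sub_cancel]; exact hq)
    · have hα' : ∀ j, min (a j * (w - x₀) j) (b j * (w - x₀) j) = α j * (w j - x₀ j) := by
        intro j
        have := hbd j
        simp only [Pi.sub_apply, hα]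
        split_ifs with hs
        · exact min_eq_left (mul_le_mul_of_nonneg_right (hab j) (by omega))
        · exact min_eq_right (mul_le_mul_of_nonpos_right (hab j) (by omega))
      simp only [hα'] at this
      exact_mod_cast this
    · have h1 := hbd j
      have h2 := hd j
      have h3 := he j
      rw [abs_le] at h2 h3
      rw [Pi.sub_apply, abs_le]
      omega

/-- One elimination step: directions with `d i = -1` bound `v` from below, those with `d i = 1` from
above, and those with `d i = 0` do not involve `v`. -/
theorem IntegrallyConvex.fix_coordinate {f : (Fin n → ℤ) → EReal} (hf : IntegrallyConvex f)
    (hi : IntOrTop f) {x₀ : Fin n → ℤ} {k₀ : ℤ} {a b : Fin n → ℤ} (hab : ∀ j, a j ≤ b j)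
    (h : ∀ d : Fin n → ℤ, (∀ j, |d j| ≤ 1) → ∀ m : ℤ, f (x₀ + d) = ((m : ℝ) : EReal) →
      k₀ + ∑ j, min (a j * d j) (b j * d j) ≤ m) (i : Fin n) :
    ∃ v, a i ≤ v ∧ v ≤ b i ∧
      ∀ d : Fin n → ℤ, (∀ j, |d j| ≤ 1) → ∀ m : ℤ, f (x₀ + d) = ((m : ℝ) : EReal) →
        k₀ + ∑ j, min (Function.update a i v j * d j) (Function.update b i v j * d j) ≤ m := by
  set W : (Fin n → ℤ) → ℤ := fun d => ∑ j ∈ Finset.univ.erase i, min (a j * d j) (b j * d j)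
  have hW : ∀ d : Fin n → ℤ, ∑ j, min (a j * d j) (b j * d j) =
      W d + min (a i * d i) (b i * d i) := fun d =>
    (Finset.sum_erase_add _ _ (Finset.mem_univ i)).symm
  set L : Set ℤ := {t | t = a i ∨ ∃ e : Fin n → ℤ, ∃ l : ℤ, (∀ j, |e j| ≤ 1) ∧ e i = -1 ∧
    f (x₀ + e) = ((l : ℝ) : EReal) ∧ t = k₀ + W e - l} with hL
  set U : Set ℤ := {t | t = b i ∨ ∃ d : Fin n → ℤ, ∃ m : ℤ, (∀ j, |d j| ≤ 1) ∧ d i = 1 ∧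
    f (x₀ + d) = ((m : ℝ) : EReal) ∧ t = m - k₀ - W d} with hU
  -- `L` and `U` consist of integers, so pairwise comparability already gives an integer `v`; this
  -- is where integrality of `f` enters.
  obtain ⟨v, hvL, hvU⟩ : (upperBounds L ∩ lowerBounds U).Nonempty := by
    refine exists_between_of_forall_le ⟨a i, Or.inl rfl⟩ ⟨b i, Or.inl rfl⟩ ?_
    rintro s (rfl | ⟨e, l, he, hei, hl, rfl⟩) t (rfl | ⟨d, m, hd, hdi, hm, rfl⟩)
    · exact hab i
    · have h1 := h d hd m hm
      have h2 := hab i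
      rw [hW, hdi, mul_one, mul_one, min_eq_left h2] at h1
      linarith
    · have h1 := h e he l hl
      have h2 := hab i
      rw [hW, hei, min_eq_right (by linarith)] at h1
      linarith
    · have : 2 * k₀ + W d + W e ≤ m + l := hf.cross_inequality hi hab h hd he hdi hei hm hl
      linarith
  refine ⟨v, hvL (Or.inl rfl), hvU (Or.inl rfl), fun d hd m hm => ?_⟩
  rw [← Finset.sum_erase_add _ _ (Finset.mem_univ i)]
  have hW' : ∑ j ∈ Finset.univ.erase i,
      min (Function.update a i v j * d j) (Function.update b i v j * d j) = W d :=
    Finset.sum_congr rfl fun j hj => by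
      rw [Function.update_of_ne (Finset.ne_of_mem_erase hj),
        Function.update_of_ne (Finset.ne_of_mem_erase hj)]
  rw [hW', Function.update_self, Function.update_self, min_self]
  have hdi := hd i
  have : d i = -1 ∨ d i = 0 ∨ d i = 1 := by rw [abs_le] at hdi; omega
  rcases this with h1 | h1 | h1
  · have := hvL (Or.inr ⟨d, m, hd, h1, hm, rfl⟩)
    rw [h1]; linarith
  · have := h d hd m hm
    rw [hW, h1] at this
    rw [h1]; simpa using this
  · have := hvU (Or.inr ⟨d, m, hd, h1, hm, rfl⟩)
    rw [h1]; linarith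

/-- Box integrality of the local subgradients of an integer-valued integrally convex function. -/
theorem IntegrallyConvex.exists_subgradient_mem_box {f : (Fin n → ℤ) → EReal}
    (hf : IntegrallyConvex f) (hi : IntOrTop f) {x₀ : Fin n → ℤ} {k₀ : ℤ} {a b : Fin n → ℤ}
    (hab : ∀ j, a j ≤ b j)
    (h : ∀ d : Fin n → ℤ, (∀ j, |d j| ≤ 1) → ∀ m : ℤ, f (x₀ + d) = ((m : ℝ) : EReal) →
      k₀ + ∑ j, min (a j * d j) (b j * d j) ≤ m) :
    ∃ p : Fin n → ℤ, (∀ j, a j ≤ p j ∧ p j ≤ b j) ∧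
      ∀ d : Fin n → ℤ, (∀ j, |d j| ≤ 1) → ∀ m : ℤ, f (x₀ + d) = ((m : ℝ) : EReal) →
        k₀ + ∑ j, p j * d j ≤ m := by
  have main : ∀ s : Finset (Fin n), ∃ a' b' : Fin n → ℤ, (∀ j ∈ s, a' j = b' j) ∧
      (∀ j, a j ≤ a' j ∧ a' j ≤ b' j ∧ b' j ≤ b j) ∧
      ∀ d : Fin n → ℤ, (∀ j, |d j| ≤ 1) → ∀ m : ℤ, f (x₀ + d) = ((m : ℝ) : EReal) →
        k₀ + ∑ j, min (a' j * d j) (b' j * d j) ≤ m := by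
    intro s
    induction s using Finset.induction_on with
    | empty => exact ⟨a, b, by simp, fun j => ⟨le_rfl, hab j, le_rfl⟩, h⟩
    | insert i s _ ih =>
      obtain ⟨a', b', hs, hbox, h'⟩ := ih
      obtain ⟨v, hav, hvb, hv⟩ := hf.fix_coordinate hi (fun j => (hbox j).2.1) h' i
      refine ⟨Function.update a' i v, Function.update b' i v, fun j hj => ?_, fun j => ?_, hv⟩
      · by_cases hji : j = i
        · subst hji; simp
        · rw [Function.update_of_ne hji, Function.update_of_ne hji]
          exact hs j (Finset.mem_of_mem_insert_of_ne hj hji)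
      · by_cases hji : j = i
        · subst hji
          have := hbox j
          simp only [Function.update_self]
          omega
        · rw [Function.update_of_ne hji, Function.update_of_ne hji]
          exact hbox j
  obtain ⟨a', b', hs, hbox, h'⟩ := main Finset.univ
  refine ⟨a', fun j => ⟨(hbox j).1, (hbox j).2.1.trans (hbox j).2.2⟩, fun d hd m hm => ?_⟩
  have := h' d hd m hm
  simpa only [← hs _ (Finset.mem_univ _), min_self] using this

/-- If every unit direction admits a vector of slopes in a product of order-connected sets of
integers, then a single vector of slopes works for all directions. -/
theorem IntegrallyConvex.exists_common_slopes {f : (Fin n → ℤ) → EReal}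
    (hf : IntegrallyConvex f) (hi : IntOrTop f) {x₀ : Fin n → ℤ} {k₀ : ℤ} {P : Fin n → Set ℤ}
    (hP : ∀ j, (P j).OrdConnected) (hne : ∀ j, (P j).Nonempty)
    (h : ∀ d : Fin n → ℤ, (∀ j, |d j| ≤ 1) → ∀ m : ℤ, f (x₀ + d) = ((m : ℝ) : EReal) →
      ∃ p : Fin n → ℤ, (∀ j, p j ∈ P j) ∧ k₀ + ∑ j, p j * d j ≤ m) :
    ∃ p : Fin n → ℤ, (∀ j, p j ∈ P j) ∧
      ∀ d : Fin n → ℤ, (∀ j, |d j| ≤ 1) → ∀ m : ℤ, f (x₀ + d) = ((m : ℝ) : EReal) →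
        k₀ + ∑ j, p j * d j ≤ m := by
  have h' : ∀ d : Fin n → ℤ, ∃ p : Fin n → ℤ, (∀ j, p j ∈ P j) ∧ ((∀ j, |d j| ≤ 1) →
      ∀ m : ℤ, f (x₀ + d) = ((m : ℝ) : EReal) → k₀ + ∑ j, p j * d j ≤ m) := by
    intro d
    by_cases hd : (∀ j, |d j| ≤ 1) ∧ ∃ m : ℤ, f (x₀ + d) = ((m : ℝ) : EReal)
    · obtain ⟨hd, m, hm⟩ := hd
      obtain ⟨p, hp, hpm⟩ := h d hd m hm
      refine ⟨p, hp, fun _ m' hm' => ?_⟩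
      have : m = m' := by
        rw [hm] at hm'
        exact_mod_cast hm'
      exact this ▸ hpm
    · choose q hq using hne
      exact ⟨q, hq, fun hd' m hm => (hd ⟨hd', m, hm⟩).elim⟩
  choose q hqP hq using h'
  set T : Finset (Fin n → ℤ) := Fintype.piFinset fun _ => Finset.Icc (-1) 1
  have hT : ∀ d : Fin n → ℤ, (∀ j, |d j| ≤ 1) → d ∈ T := fun d hd =>
    Fintype.mem_piFinset.2 fun j => Finset.mem_Icc.2 (abs_le.1 (hd j))
  have hTne : T.Nonempty := ⟨0, hT 0 (by simp)⟩
  -- `P j` may be unbounded; the extreme slopes over the finitely many unit directions span a finite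
  -- box, which stays inside by order-connectedness.
  choose lo hloT hlo using fun j => T.exists_min_image (fun d => q d j) hTne
  choose hi' hhiT hhi using fun j => T.exists_max_image (fun d => q d j) hTne
  have hbox : ∀ d : Fin n → ℤ, (∀ j, |d j| ≤ 1) → ∀ m : ℤ, f (x₀ + d) = ((m : ℝ) : EReal) →
      k₀ + ∑ j, min (q (lo j) j * d j) (q (hi' j) j * d j) ≤ m := by
    intro d hd m hm
    refine le_trans (add_le_add_right (Finset.sum_le_sum fun j _ => ?_) _) (hq d hd m hm)
    rcases le_total 0 (d j) with h0 | h0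
    · exact (min_le_left _ _).trans (mul_le_mul_of_nonneg_right (hlo j d (hT d hd)) h0)
    · exact (min_le_right _ _).trans (mul_le_mul_of_nonpos_right (hhi j d (hT d hd)) h0)
  obtain ⟨p, hp, hp'⟩ := hf.exists_subgradient_mem_box hi (fun j => hlo j _ (hhiT j)) hbox
  exact ⟨p, fun j => (hP j).out (hqP _ j) (hqP _ j) (hp j), hp'⟩

end BoxIntegrality

/-! ### Univariate discrete concave functions and their integer supergradients -/

section Concave

theorem IntOrBot.mem_effDom_iff {α : Type*} {h : α → EReal} (hi : IntOrBot h) {x : α} :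
    x ∈ effDom h ↔ ∃ k : ℤ, h x = ((k : ℝ) : EReal) := by
  constructor
  · intro hx
    exact (hi x).resolve_left hx.1.ne'
  · rintro ⟨k, hk⟩
    simp only [effDom, Set.mem_ofPred_eq, hk]
    exact ⟨EReal.bot_lt_coe _, EReal.coe_lt_top _⟩

theorem coe_add_le_two_mul_iff {r s t : ℤ} :
    ((r : ℝ) : EReal) + ((s : ℝ) : EReal) ≤ 2 * ((t : ℝ) : EReal) ↔ r + s ≤ 2 * t := by
  have h2 : (2 : EReal) = ((2 : ℝ) : EReal) := rfl
  rw [h2, ← EReal.coe_add, ← EReal.coe_mul, EReal.coe_le_coe_iff]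
  exact_mod_cast Iff.rfl

/-- A concave sequence lies below the line through its first value with slope at least its first
increment. -/
theorem concave_seq_le {φ : ℕ → EReal} (hi : IntOrBot φ)
    (hc : ∀ j, φ j + φ (j + 2) ≤ 2 * φ (j + 1))
    (hdown : ∀ j, φ (j + 1) ≠ ⊥ → φ j ≠ ⊥) {c v : ℤ} (h0 : φ 0 = ((c : ℝ) : EReal))
    (h1 : φ 1 ≤ (((c + v : ℤ) : ℝ) : EReal)) (j : ℕ) :
    φ j ≤ (((c + v * j : ℤ) : ℝ) : EReal) := by
  have hdown' : ∀ j (t : ℤ), φ (j + 1) = ((t : ℝ) : EReal) →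
      ∃ s : ℤ, φ j = ((s : ℝ) : EReal) := fun j t ht =>
    (hi j).resolve_left (hdown j (by rw [ht]; exact EReal.coe_ne_bot _))
  -- `hdown` is essential: concavity alone lets finite values reappear after two consecutive `⊥`.
  have hstep : ∀ j (s t : ℤ), φ j = ((s : ℝ) : EReal) → φ (j + 1) = ((t : ℝ) : EReal) →
      t ≤ s + v := by
    intro j
    induction j with
    | zero =>
      intro s t hs ht
      rw [h0] at hs
      rw [zero_add] at ht
      rw [ht] at h1
      have e1 : c = s := by exact_mod_cast hs
      have e2 : t ≤ c + v := by exact_mod_cast EReal.coe_le_coe_iff.1 h1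
      omega
    | succ j ih =>
      intro s t hs ht
      obtain ⟨r, hr⟩ := hdown' j s hs
      have e1 := ih r s hr hs
      have e2 := hc j
      rw [hr, hs, ht, coe_add_le_two_mul_iff] at e2
      omega
  induction j with
  | zero => simp [h0]
  | succ j ih =>
    rcases hi (j + 1) with hb | ⟨t, ht⟩
    · rw [hb]; exact bot_le
    · obtain ⟨s, hs⟩ := hdown' j t ht
      have e1 := hstep j s t hs ht
      rw [hs] at ih
      have e2 : s ≤ c + v * j := by exact_mod_cast EReal.coe_le_coe_iff.1 ih
      rw [ht, EReal.coe_le_coe_iff, Int.cast_le]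
      push_cast
      linarith

/-- The integer supergradients at `k₀` of a function `ψ` with `ψ k₀ = c`. -/
def superSlopes (ψ : ℤ → EReal) (k₀ c : ℤ) : Set ℤ :=
  {v | ∀ k : ℤ, ψ k ≤ (((c + v * (k - k₀) : ℤ) : ℝ) : EReal)}

theorem ordConnected_superSlopes (ψ : ℤ → EReal) (k₀ c : ℤ) :
    (superSlopes ψ k₀ c).OrdConnected := by
  refine ⟨fun v hv w hw u hu k => ?_⟩
  rcases le_total k₀ k with h | h
  · refine (hv k).trans ?_
    rw [EReal.coe_le_coe_iff, Int.cast_le]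
    have := mul_le_mul_of_nonneg_right hu.1 (sub_nonneg.2 h)
    linarith
  · refine (hw k).trans ?_
    rw [EReal.coe_le_coe_iff, Int.cast_le]
    have := mul_le_mul_of_nonpos_right hu.2 (sub_nonpos.2 h)
    linarith

/-- Only the two neighbors of `k₀` matter, because increments are nonincreasing. Both half-lines
reduce to `concave_seq_le`, the left one reflected with slope `-v`. -/
theorem DiscreteConcave.mem_superSlopes {ψ : ℤ → EReal} (hψ : DiscreteConcave ψ)
    (hi : IntOrBot ψ) {k₀ c v : ℤ} (h0 : ψ k₀ = ((c : ℝ) : EReal))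
    (h1 : ψ (k₀ + 1) ≤ (((c + v : ℤ) : ℝ) : EReal))
    (h2 : ψ (k₀ - 1) ≤ (((c - v : ℤ) : ℝ) : EReal)) : v ∈ superSlopes ψ k₀ c := by
  have hk₀ : k₀ ∈ effDom ψ := hi.mem_effDom_iff.2 ⟨c, h0⟩
  have hne : ∀ k, ψ k ≠ ⊥ → k ∈ effDom ψ := fun k hk =>
    hi.mem_effDom_iff.2 ((hi k).resolve_left hk)
  intro k
  rcases le_total k₀ k with h | h
  · obtain ⟨j, rfl⟩ := Int.le.dest h
    have := concave_seq_le (φ := fun j : ℕ => ψ (k₀ + j)) (fun j => hi _) (fun j => ?_)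
      (fun j hj => ?_) (c := c) (v := v) (by simpa using h0) (by simpa using h1) j
    · rwa [add_sub_cancel_left]
    · have := hψ.2 (k₀ + j + 1)
      push_cast
      convert this using 3 <;> ring
    · exact (hψ.1.out hk₀ (hne _ hj) ⟨by omega, by push_cast; omega⟩ : k₀ + j ∈ effDom ψ).1.ne'
  · obtain ⟨j, rfl⟩ : ∃ j : ℕ, k = k₀ - j := ⟨(k₀ - k).toNat, by omega⟩
    have := concave_seq_le (φ := fun j : ℕ => ψ (k₀ - j)) (fun j => hi _) (fun j => ?_)
      (fun j hj => ?_) (c := c) (v := -v) (by simpa using h0) (by simpa [sub_eq_add_neg] using h2) j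
    · convert this using 4; ring
    · have := hψ.2 (k₀ - j - 1)
      push_cast
      rw [add_comm]
      convert this using 3 <;> ring
    · exact (hψ.1.out (hne _ hj) hk₀ ⟨by push_cast; omega, by omega⟩ : k₀ - j ∈ effDom ψ).1.ne'

theorem DiscreteConcave.exists_superSlope_right {ψ : ℤ → EReal} (hψ : DiscreteConcave ψ)
    (hi : IntOrBot ψ) {k₀ c r : ℤ} (h0 : ψ k₀ = ((c : ℝ) : EReal))
    (hr : ψ (k₀ + 1) ≤ (((c + r : ℤ) : ℝ) : EReal)) : ∃ v ∈ superSlopes ψ k₀ c, v ≤ r := by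
  rcases hi (k₀ + 1) with hb | ⟨s, hs⟩ <;> rcases hi (k₀ - 1) with hb' | ⟨s', hs'⟩
  · exact ⟨r, hψ.mem_superSlopes hi h0 hr (by simp [hb']), le_rfl⟩
  -- With `⊥` on the right, the only constraint on the slope is the upper bound `c - s'` from the
  -- left neighbor.
  · refine ⟨min r (c - s'), hψ.mem_superSlopes hi h0 (by simp [hb]) ?_, min_le_left _ _⟩
    rw [hs', EReal.coe_le_coe_iff, Int.cast_le]
    omega
  · exact ⟨r, hψ.mem_superSlopes hi h0 hr (by simp [hb']), le_rfl⟩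
  · refine ⟨s - c, hψ.mem_superSlopes hi h0 (by simp [hs]) ?_, ?_⟩
    · have := hψ.2 k₀
      rw [hs, hs', h0, coe_add_le_two_mul_iff] at this
      rw [hs', EReal.coe_le_coe_iff, Int.cast_le]
      omega
    · rw [hs, EReal.coe_le_coe_iff, Int.cast_le] at hr
      omega

theorem DiscreteConcave.exists_superSlope_left {ψ : ℤ → EReal} (hψ : DiscreteConcave ψ)
    (hi : IntOrBot ψ) {k₀ c r : ℤ} (h0 : ψ k₀ = ((c : ℝ) : EReal))
    (hr : ψ (k₀ - 1) ≤ (((c + r : ℤ) : ℝ) : EReal)) : ∃ v ∈ superSlopes ψ k₀ c, -v ≤ r := by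
  rcases hi (k₀ - 1) with hb | ⟨s, hs⟩ <;> rcases hi (k₀ + 1) with hb' | ⟨s', hs'⟩
  · exact ⟨-r, hψ.mem_superSlopes hi h0 (by simp [hb']) (by simp [hb]), by simp⟩
  · refine ⟨max (-r) (s' - c), hψ.mem_superSlopes hi h0 ?_ (by simp [hb]), by omega⟩
    rw [hs', EReal.coe_le_coe_iff, Int.cast_le]
    omega
  · exact ⟨-r, hψ.mem_superSlopes hi h0 (by simp [hb']) (by simpa using hr), by simp⟩
  · refine ⟨c - s, hψ.mem_superSlopes hi h0 ?_ (by simp [hs]), ?_⟩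
    · have := hψ.2 k₀
      rw [hs, hs', h0, coe_add_le_two_mul_iff] at this
      rw [hs', EReal.coe_le_coe_iff, Int.cast_le]
      omega
    · rw [hs, EReal.coe_le_coe_iff, Int.cast_le] at hr
      omega

theorem DiscreteConcave.nonempty_superSlopes {ψ : ℤ → EReal} (hψ : DiscreteConcave ψ)
    (hi : IntOrBot ψ) {k₀ c : ℤ} (h0 : ψ k₀ = ((c : ℝ) : EReal)) :
    (superSlopes ψ k₀ c).Nonempty := by
  obtain ⟨r, hr⟩ : ∃ r : ℤ, ψ (k₀ + 1) ≤ (((c + r : ℤ) : ℝ) : EReal) := by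
    rcases hi (k₀ + 1) with hb | ⟨s, hs⟩
    · exact ⟨0, by simp [hb]⟩
    · exact ⟨s - c, by simp [hs]⟩
  obtain ⟨v, hv, -⟩ := hψ.exists_superSlope_right hi h0 hr
  exact ⟨v, hv⟩

/-- For a unit step `t`, the increment of a discrete concave function is the infimum of `v * t`
over its integer supergradients `v`. -/
theorem DiscreteConcave.exists_superSlope {ψ : ℤ → EReal} (hψ : DiscreteConcave ψ)
    (hi : IntOrBot ψ) {k₀ c t r : ℤ} (h0 : ψ k₀ = ((c : ℝ) : EReal)) (ht : |t| ≤ 1)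
    (hr : ψ (k₀ + t) ≤ (((c + r : ℤ) : ℝ) : EReal)) : ∃ v ∈ superSlopes ψ k₀ c, v * t ≤ r := by
  have : t = -1 ∨ t = 0 ∨ t = 1 := by rw [abs_le] at ht; omega
  rcases this with rfl | rfl | rfl
  · simpa using hψ.exists_superSlope_left hi h0 hr
  · obtain ⟨v, hv⟩ := hψ.nonempty_superSlopes hi h0
    rw [add_zero, h0, EReal.coe_le_coe_iff, Int.cast_le] at hr
    exact ⟨v, hv, by omega⟩
  · simpa using hψ.exists_superSlope_right hi h0 hr

end Concave

theorem coe_sum_int {ι : Type*} (s : Finset ι) (g : ι → ℤ) :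
    (((∑ i ∈ s, g i : ℤ) : ℝ) : EReal) = ∑ i ∈ s, ((g i : ℝ) : EReal) := by
  rw [Int.cast_sum, coe_sum_real]

theorem sum_eq_bot {ι : Type*} {s : Finset ι} {u : ι → EReal} {i : ι} (his : i ∈ s)
    (hi : u i = ⊥) : ∑ j ∈ s, u j = ⊥ := by
  classical
  rw [← Finset.add_sum_erase s u his, hi, EReal.bot_add]

/-- An integer upper bound on a sum splits into integer upper bounds on the terms. -/
theorem IntOrBot.exists_split {ι : Type*} [Fintype ι] {u : ι → EReal} (hu : IntOrBot u) {C : ℤ}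
    (h : ∑ j, u j ≤ ((C : ℝ) : EReal)) :
    ∃ r : ι → ℤ, (∀ j, u j ≤ ((r j : ℝ) : EReal)) ∧ ∑ j, r j ≤ C := by
  classical
  have hb : ∀ j, ∃ k : ℤ, u j ≤ ((k : ℝ) : EReal) ∧ (u j ≠ ⊥ → u j = ((k : ℝ) : EReal)) := by
    intro j
    rcases hu j with h | ⟨k, hk⟩
    · exact ⟨0, by simp [h], fun h' => (h' h).elim⟩
    · exact ⟨k, hk.le, fun _ => hk⟩
  choose r hr hr' using hb
  by_cases hbot : ∃ i, u i = ⊥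
  · obtain ⟨i, hi⟩ := hbot
    -- The `⊥` term admits any bound, so it absorbs the remainder.
    refine ⟨Function.update r i (C - ∑ j ∈ Finset.univ.erase i, r j), fun j => ?_, ?_⟩
    · by_cases hji : j = i
      · subst hji; simp [hi]
      · rw [Function.update_of_ne hji]; exact hr j
    · rw [← Finset.add_sum_erase _ _ (Finset.mem_univ i), Function.update_self,
        Finset.sum_congr rfl fun j hj => Function.update_of_ne (Finset.ne_of_mem_erase hj) _ _]
      linarith
  · push Not at hbot
    refine ⟨r, hr, ?_⟩
    rw [Finset.sum_congr rfl fun j _ => hr' j (hbot j), ← coe_sum_int,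
      EReal.coe_le_coe_iff] at h
    exact_mod_cast h

/-! ### Weak and strong duality -/

section Duality

variable {n : ℕ}

theorem IntSeparableConcave.intOrBot {Ψ : (Fin n → ℤ) → EReal} (hΨ : IntSeparableConcave Ψ) :
    IntOrBot Ψ := by
  obtain ⟨ψ, hi, -, hsum⟩ := hΨ
  intro x
  rw [hsum]
  by_cases hbot : ∃ i, ψ i (x i) = ⊥
  · obtain ⟨i, h⟩ := hbot
    exact Or.inl (sum_eq_bot (Finset.mem_univ i) h)
  · push Not at hbot
    choose k hk using fun i => (hi i (x i)).resolve_left (hbot i)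
    exact Or.inr ⟨∑ i, k i, by rw [coe_sum_int]; exact Finset.sum_congr rfl fun i _ => hk i⟩

/-- At a minimizer of `f - Ψ` there is a common integer subgradient of `f` and supergradient
of `Ψ`. -/
theorem exists_common_subgradient {f Ψ : (Fin n → ℤ) → EReal} (hf : IntegrallyConvex f)
    (hi : IntOrTop f) (hΨ : IntSeparableConcave Ψ) {x₀ : Fin n → ℤ} {k₀ c : ℤ}
    (hfx : f x₀ = ((k₀ : ℝ) : EReal)) (hΨx : Ψ x₀ = ((c : ℝ) : EReal))
    (hmin : ∀ x, f x₀ - Ψ x₀ ≤ f x - Ψ x) :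
    ∃ p : Fin n → ℤ, (∀ x, (((k₀ + pairing p (x - x₀) : ℤ) : ℝ) : EReal) ≤ f x) ∧
      ∀ x, Ψ x ≤ (((c + pairing p (x - x₀) : ℤ) : ℝ) : EReal) := by
  obtain ⟨ψ, hψi, hψ, hsum⟩ := hΨ
  have hfin : ∀ j, ∃ k : ℤ, ψ j (x₀ j) = ((k : ℝ) : EReal) := fun j =>
    (hψi j _).resolve_left fun hj => by
      rw [hsum, sum_eq_bot (Finset.mem_univ j) hj] at hΨx
      exact EReal.coe_ne_bot _ hΨx.symm
  choose γ hγ using hfin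
  have hγc : ∑ j, γ j = c := by
    rw [hsum, Finset.sum_congr rfl fun j _ => hγ j, ← coe_sum_int] at hΨx
    exact_mod_cast hΨx
  obtain ⟨p, hpP, hp⟩ := hf.exists_common_slopes hi (x₀ := x₀) (k₀ := k₀)
    (P := fun j => superSlopes (ψ j) (x₀ j) (γ j))
    (fun j => ordConnected_superSlopes _ _ _)
    (fun j => (hψ j).nonempty_superSlopes (hψi j) (hγ j)) (by
      intro d hd m hm
      have h1 : ∑ j, ψ j (x₀ j + d j) ≤ (((c + m - k₀ : ℤ) : ℝ) : EReal) := by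
        have h2 := hmin (x₀ + d)
        rw [hfx, hΨx, hm, hsum] at h2
        simp only [Pi.add_apply] at h2
        generalize ∑ j, ψ j (x₀ j + d j) = S at h2 ⊢
        induction S with
        | bot => exact bot_le
        | top => simp [← EReal.coe_sub] at h2
        | coe s =>
          rw [← EReal.coe_sub, ← EReal.coe_sub, EReal.coe_le_coe_iff] at h2
          rw [EReal.coe_le_coe_iff]
          push_cast
          linarith
      -- Separability lets the slope for `d` be chosen coordinatewise, once the bound on `Ψ (x₀ +
      -- d)` is split.
      obtain ⟨r, hr, hrC⟩ := IntOrBot.exists_split (fun j => hψi j _) h1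
      have h3 : ∀ j, ∃ v ∈ superSlopes (ψ j) (x₀ j) (γ j), v * d j ≤ r j - γ j := fun j =>
        (hψ j).exists_superSlope (hψi j) (hγ j) (hd j) (by rw [add_sub_cancel]; exact hr j)
      choose q hqP hq using h3
      refine ⟨q, hqP, ?_⟩
      have h4 := Finset.sum_le_sum fun j (_ : j ∈ Finset.univ) => hq j
      rw [Finset.sum_sub_distrib, hγc] at h4
      linarith)
  refine ⟨p, fun x => ?_, fun x => ?_⟩
  · rcases hi x with hx | ⟨m, hm⟩
    · rw [hx]; exact le_top
    · rw [hm, EReal.coe_le_coe_iff, Int.cast_le]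
      refine hf.subgradient_of_local hi hfx (fun y hy m hm => ?_) x m hm
      exact hp (y - x₀) hy m (by rw [add_sub_cancel]; exact hm)
  · rw [hsum, pairing, ← hγc, ← Finset.sum_add_distrib, coe_sum_int]
    exact Finset.sum_le_sum fun j _ => hpP j (x j)

theorem pairing_sub (p x y : Fin n → ℤ) : pairing p (x - y) = pairing p x - pairing p y := by
  simp [pairing, mul_sub]

theorem convexConj_ge {f : (Fin n → ℤ) → EReal} {x : Fin n → ℤ} {k : ℤ}
    (hx : f x = ((k : ℝ) : EReal)) (q : Fin n → ℤ) :
    (((pairing q x - k : ℤ) : ℝ) : EReal) ≤ convexConj f q := by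
  refine le_trans (le_of_eq ?_) (le_iSup _ x)
  rw [hx, Int.cast_sub, EReal.coe_sub]

theorem concaveConj_le {Ψ : (Fin n → ℤ) → EReal} {x : Fin n → ℤ} {c : ℤ}
    (hx : Ψ x = ((c : ℝ) : EReal)) (q : Fin n → ℤ) :
    concaveConj Ψ q ≤ (((pairing q x - c : ℤ) : ℝ) : EReal) := by
  refine le_trans (iInf_le _ x) (le_of_eq ?_)
  rw [hx, Int.cast_sub, EReal.coe_sub]

theorem convexConj_le_of_subgradient {f : (Fin n → ℤ) → EReal} {p x₀ : Fin n → ℤ} {k₀ : ℤ}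
    (hp : ∀ x, (((k₀ + pairing p (x - x₀) : ℤ) : ℝ) : EReal) ≤ f x) :
    convexConj f p ≤ (((pairing p x₀ - k₀ : ℤ) : ℝ) : EReal) := by
  refine iSup_le fun x => (EReal.sub_le_sub le_rfl (hp x)).trans (le_of_eq ?_)
  rw [← EReal.coe_sub, pairing_sub]
  rw [EReal.coe_eq_coe_iff]
  push_cast
  ring

theorem le_concaveConj_of_supergradient {Ψ : (Fin n → ℤ) → EReal} {p x₀ : Fin n → ℤ} {c : ℤ}
    (hp : ∀ x, Ψ x ≤ (((c + pairing p (x - x₀) : ℤ) : ℝ) : EReal)) :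
    (((pairing p x₀ - c : ℤ) : ℝ) : EReal) ≤ concaveConj Ψ p := by
  refine le_iInf fun x => le_trans (le_of_eq ?_) (EReal.sub_le_sub le_rfl (hp x))
  rw [← EReal.coe_sub, pairing_sub]
  rw [EReal.coe_eq_coe_iff]
  push_cast
  ring

/-- Weak duality at a point of both effective domains. -/
theorem concaveConj_sub_convexConj_le {f Ψ : (Fin n → ℤ) → EReal} {x : Fin n → ℤ} {k c : ℤ}
    (hf : f x = ((k : ℝ) : EReal)) (hΨ : Ψ x = ((c : ℝ) : EReal)) (q : Fin n → ℤ) :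
    concaveConj Ψ q - convexConj f q ≤ (((k - c : ℤ) : ℝ) : EReal) := by
  refine (EReal.sub_le_sub (concaveConj_le hΨ q) (convexConj_ge hf q)).trans (le_of_eq ?_)
  rw [← EReal.coe_sub]
  rw [EReal.coe_eq_coe_iff]
  push_cast
  ring

theorem strong_duality_of_minimizer {f Ψ : (Fin n → ℤ) → EReal} (hf : IntegrallyConvex f)
    (hi : IntOrTop f) (hΨ : IntSeparableConcave Ψ) {x₀ : Fin n → ℤ} {k₀ c : ℤ}
    (hfx : f x₀ = ((k₀ : ℝ) : EReal)) (hΨx : Ψ x₀ = ((c : ℝ) : EReal))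
    (hmin : ∀ x, f x₀ - Ψ x₀ ≤ f x - Ψ x) :
    IsLeast (Set.range fun x : Fin n → ℤ => f x - Ψ x) (((k₀ - c : ℤ) : ℝ) : EReal) ∧
      IsGreatest (Set.range fun p : Fin n → ℤ => concaveConj Ψ p - convexConj f p)
        (((k₀ - c : ℤ) : ℝ) : EReal) := by
  have hval : f x₀ - Ψ x₀ = (((k₀ - c : ℤ) : ℝ) : EReal) := by
    rw [hfx, hΨx, Int.cast_sub, EReal.coe_sub]
  obtain ⟨p, hp, hp'⟩ := exists_common_subgradient hf hi hΨ hfx hΨx hmin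
  refine ⟨⟨⟨x₀, hval⟩, ?_⟩, ⟨p, le_antisymm (concaveConj_sub_convexConj_le hfx hΨx p) ?_⟩, ?_⟩
  · rintro _ ⟨x, rfl⟩
    exact hval ▸ hmin x
  · refine le_trans (le_of_eq ?_) (EReal.sub_le_sub (le_concaveConj_of_supergradient hp')
      (convexConj_le_of_subgradient hp))
    rw [← EReal.coe_sub]
    rw [EReal.coe_eq_coe_iff]
    push_cast
    ring
  · rintro _ ⟨q, rfl⟩
    exact concaveConj_sub_convexConj_le hfx hΨx q

/-- If `f - Ψ` is bounded below and somewhere finite then its minimum is attained. -/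
theorem exists_minimizer {f Ψ : (Fin n → ℤ) → EReal} (hi : IntOrTop f) (hΨ : IntOrBot Ψ)
    {b : ℤ} (hb : ∀ x, ((b : ℝ) : EReal) ≤ f x - Ψ x) (hne : ∃ x, f x - Ψ x ≠ ⊤) :
    ∃ (x₀ : Fin n → ℤ) (k₀ c : ℤ), f x₀ = ((k₀ : ℝ) : EReal) ∧ Ψ x₀ = ((c : ℝ) : EReal) ∧
      ∀ x, f x₀ - Ψ x₀ ≤ f x - Ψ x := by
  have hcases : ∀ x, f x - Ψ x = ⊤ ∨
      ∃ k c : ℤ, f x = ((k : ℝ) : EReal) ∧ Ψ x = ((c : ℝ) : EReal) := by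
    intro x
    rcases hΨ x with h | ⟨c, hc⟩
    · left; rcases hi x with h' | ⟨k, hk⟩
      · rw [h, h']; rfl
      · rw [h, hk]; exact EReal.coe_sub_bot _
    · rcases hi x with h' | ⟨k, hk⟩
      · left; rw [hc, h']; exact EReal.top_sub_coe _
      · exact Or.inr ⟨k, c, hk, hc⟩
  have hsub : ∀ k c : ℤ, ((k : ℝ) : EReal) - ((c : ℝ) : EReal) = (((k - c : ℤ) : ℝ) : EReal) := by
    intro k c
    rw [Int.cast_sub, EReal.coe_sub]
  obtain ⟨m, ⟨x₀, k₀, c, hk, hc, rfl⟩, hm⟩ := Int.exists_least_of_bdd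
    (P := fun m => ∃ (x : Fin n → ℤ) (k c : ℤ), f x = ((k : ℝ) : EReal) ∧
      Ψ x = ((c : ℝ) : EReal) ∧ m = k - c)
    ⟨b, by
      rintro _ ⟨x, k, c, hk, hc, rfl⟩
      have := hb x
      rw [hk, hc, hsub, EReal.coe_le_coe_iff, Int.cast_le] at this
      exact this⟩
    (by
      obtain ⟨x, hx⟩ := hne
      obtain ⟨k, c, hk, hc⟩ := (hcases x).resolve_left hx
      exact ⟨k - c, x, k, c, hk, hc, rfl⟩)
  refine ⟨x₀, k₀, c, hk, hc, fun x => ?_⟩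
  rcases hcases x with h | ⟨k, c', hk', hc'⟩
  · rw [h]; exact le_top
  · rw [hk, hc, hk', hc', hsub, hsub, EReal.coe_le_coe_iff, Int.cast_le]
    exact hm _ ⟨x, k, c', hk', hc', rfl⟩

/-- The distance of an integer to a set of integers. -/
noncomputable def intDist (B : Set ℤ) (k : ℤ) : ℕ := sInf {d | ∃ j ∈ B, d = (k - j).natAbs}

theorem intDist_le {B : Set ℤ} {j : ℤ} (hj : j ∈ B) (k : ℤ) : intDist B k ≤ (k - j).natAbs :=
  Nat.sInf_le ⟨j, hj, rfl⟩

theorem exists_intDist_eq {B : Set ℤ} (hB : B.Nonempty) (k : ℤ) :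
    ∃ j ∈ B, intDist B k = (k - j).natAbs :=
  Nat.sInf_mem (s := {d | ∃ j ∈ B, d = (k - j).natAbs})
    (hB.elim fun j hj => ⟨_, j, hj, rfl⟩)

theorem intDist_eq_zero {B : Set ℤ} {k : ℤ} (hk : k ∈ B) : intDist B k = 0 := by
  have := intDist_le hk k
  omega

theorem intDist_pos {B : Set ℤ} (hB : B.Nonempty) {k : ℤ} (hk : k ∉ B) : 0 < intDist B k := by
  obtain ⟨j, hj, h⟩ := exists_intDist_eq hB k
  have : k ≠ j := fun h => hk (h ▸ hj)
  omega

/-- For `k ∉ B`, the points of `B` nearest to `k - 1` and `k + 1` lie on the same side of `k`, so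
the shifts by 1 cancel. -/
theorem two_mul_intDist_le {B : Set ℤ} (hB : B.Nonempty) (hc : B.OrdConnected) (k : ℤ) :
    2 * intDist B k ≤ intDist B (k - 1) + intDist B (k + 1) := by
  by_cases hk : k ∈ B
  · rw [intDist_eq_zero hk]; omega
  obtain ⟨j, hj, h⟩ := exists_intDist_eq hB (k - 1)
  obtain ⟨j', hj', h'⟩ := exists_intDist_eq hB (k + 1)
  have h1 := intDist_le hj k
  have h2 := intDist_le hj' k
  have h3 : ¬(j ≤ k ∧ k ≤ j') := fun h => hk (hc.out hj hj' h)
  have h4 : ¬(j' ≤ k ∧ k ≤ j) := fun h => hk (hc.out hj' hj h)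
  omega

/-- The linear function `⟨q, ·⟩` penalized by a multiple of the `ℓ¹`-distance to a box. -/
theorem intSeparableConcave_penalty {B : Fin n → Set ℤ} (hB : ∀ i, (B i).Nonempty)
    (hc : ∀ i, (B i).OrdConnected) (q : Fin n → ℤ) (t : ℕ) :
    IntSeparableConcave fun x =>
      (((pairing q x - t * ∑ i, (intDist (B i) (x i) : ℤ) : ℤ) : ℝ) : EReal) := by
  refine ⟨fun i k => (((q i * k - t * (intDist (B i) k : ℤ) : ℤ) : ℝ) : EReal),
    fun i k => Or.inr ⟨_, rfl⟩, fun i => ⟨?_, fun k => ?_⟩, fun x => ?_⟩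
  · have : effDom (fun k : ℤ => (((q i * k - t * (intDist (B i) k : ℤ) : ℤ) : ℝ) : EReal)) =
        Set.univ :=
      Set.eq_univ_of_forall fun k => ⟨EReal.bot_lt_coe _, EReal.coe_lt_top _⟩
    rw [this]
    exact Set.ordConnected_univ
  · rw [coe_add_le_two_mul_iff]
    have h : (2 * intDist (B i) k : ℤ) ≤ intDist (B i) (k - 1) + intDist (B i) (k + 1) := by
      exact_mod_cast two_mul_intDist_le (hB i) (hc i) k
    have := mul_le_mul_of_nonneg_left h (Int.natCast_nonneg t)
    linarith
  · simp only [← coe_sum_int, pairing, Finset.mul_sum, Finset.sum_sub_distrib]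

/-- If the effective domains are disjoint then the dual problem is unbounded as soon as it is
feasible. -/
theorem exists_dual_ge {f Ψ : (Fin n → ℤ) → EReal} (hf : IntegrallyConvex f)
    (hi : IntOrTop f) (hfd : (effDom f).Nonempty) (hΨ : IntSeparableConcave Ψ)
    (hΨd : (effDom Ψ).Nonempty) (hdisj : Disjoint (effDom f) (effDom Ψ)) {q : Fin n → ℤ}
    {F G : ℤ} (hF : convexConj f q ≤ ((F : ℝ) : EReal)) (hG : ((G : ℝ) : EReal) ≤ concaveConj Ψ q)
    (t : ℕ) :
    ∃ p, (((G - F + t : ℤ) : ℝ) : EReal) ≤ concaveConj Ψ p - convexConj f p := by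
  have hΨb := hΨ.intOrBot
  obtain ⟨ψ, hψi, hψ, hsum⟩ := hΨ
  have hbox : ∀ x, x ∈ effDom Ψ ↔ ∀ i, x i ∈ effDom (ψ i) := by
    intro x
    rw [hΨb.mem_effDom_iff]
    constructor
    · rintro ⟨k, hk⟩ i
      refine (hψi i).mem_effDom_iff.2 ((hψi i _).resolve_left fun h => ?_)
      rw [hsum, sum_eq_bot (Finset.mem_univ i) h] at hk
      exact EReal.coe_ne_bot _ hk.symm
    · intro h
      choose k hk using fun i => (hψi i).mem_effDom_iff.1 (h i)
      exact ⟨∑ i, k i, by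
        rw [hsum, coe_sum_int]; exact Finset.sum_congr rfl fun i _ => hk i⟩
  obtain ⟨y, hy⟩ := hΨd
  have hBne : ∀ i, (effDom (ψ i)).Nonempty := fun i => ⟨y i, (hbox y).1 hy i⟩
  set D : (Fin n → ℤ) → ℤ := fun x => ∑ i, (intDist (effDom (ψ i)) (x i) : ℤ) with hD
  -- `Φ` equals `⟨q, ·⟩` on `dom Ψ` and is at most `⟨q, ·⟩ - t` on `dom f`, whence `f - Φ ≥ t - F`.
  set Φ : (Fin n → ℤ) → EReal := fun x => (((pairing q x - t * D x : ℤ) : ℝ) : EReal) with hΦdef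
  have hΦ : IntSeparableConcave Φ :=
    intSeparableConcave_penalty hBne (fun i => (hψ i).1) q t
  have hD0 : ∀ x ∈ effDom Ψ, D x = 0 := fun x hx =>
    Finset.sum_eq_zero fun i _ => by rw [intDist_eq_zero ((hbox x).1 hx i)]; rfl
  have hD1 : ∀ x ∈ effDom f, 1 ≤ D x := by
    intro x hx
    have hx' : x ∉ effDom Ψ := fun h => Set.disjoint_left.1 hdisj hx h
    rw [hbox] at hx'
    push Not at hx'
    obtain ⟨i, hi'⟩ := hx'
    have h1 := Finset.single_le_sum (f := fun i => (intDist (effDom (ψ i)) (x i) : ℤ))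
      (fun j _ => Int.natCast_nonneg _) (Finset.mem_univ i)
    have h2 := intDist_pos (hBne i) hi'
    have h3 : (1 : ℤ) ≤ intDist (effDom (ψ i)) (x i) := by exact_mod_cast h2
    exact h3.trans h1
  have hfF : ∀ x (k : ℤ), f x = ((k : ℝ) : EReal) → pairing q x - k ≤ F := by
    intro x k hk
    have := (convexConj_ge hk q).trans hF
    exact_mod_cast EReal.coe_le_coe_iff.1 this
  have hlow : ∀ x (k : ℤ), f x = ((k : ℝ) : EReal) →
      t - F ≤ k - (pairing q x - t * D x) := by
    intro x k hk
    have h1 := hfF x k hk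
    have h2 := hD1 x (by simp [effDom, hk])
    have h3 := mul_le_mul_of_nonneg_left h2 (Int.natCast_nonneg t)
    linarith
  obtain ⟨x₀, k₀, c, hk₀, hc, hmin⟩ := exists_minimizer (f := f) (Ψ := Φ) hi hΦ.intOrBot
    (b := t - F) (fun x => by
      rcases hi x with h | ⟨k, hk⟩
      · rw [h, hΦdef, EReal.top_sub_coe]; exact le_top
      · rw [hk, hΦdef, ← EReal.coe_sub, EReal.coe_le_coe_iff]
        exact_mod_cast hlow x k hk)
    (by
      obtain ⟨x, hx⟩ := hfd
      obtain ⟨k, hk⟩ := (hi x).resolve_left hx.2.ne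
      exact ⟨x, by rw [hk, hΦdef, ← EReal.coe_sub]; exact EReal.coe_ne_top _⟩)
  obtain ⟨p, hp, hp'⟩ := exists_common_subgradient hf hi hΦ hk₀ hc hmin
  have hc' : pairing q x₀ - t * D x₀ = c := by
    exact_mod_cast (show (((pairing q x₀ - t * D x₀ : ℤ) : ℝ) : EReal) = _ from hc)
  have hkc := hlow x₀ k₀ hk₀
  rw [hc'] at hkc
  -- On `dom Ψ` the penalty vanishes, so `⟨q, x⟩ ≤ c + ⟨p, x - x₀⟩`; combine with `G ≤ ⟨q, x⟩ - Ψ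
  -- x`.
  have hconc : (((G - c + pairing p x₀ : ℤ) : ℝ) : EReal) ≤ concaveConj Ψ p := by
    refine le_iInf fun x => ?_
    rcases hΨb x with h | ⟨s, hs⟩
    · rw [h, EReal.coe_sub_bot]; exact le_top
    · have h1 := hG.trans (concaveConj_le hs q)
      rw [EReal.coe_le_coe_iff, Int.cast_le] at h1
      have h2 := hp' x
      rw [hΦdef, EReal.coe_le_coe_iff, Int.cast_le, pairing_sub,
        hD0 x (hΨb.mem_effDom_iff.2 ⟨s, hs⟩)] at h2
      rw [hs, ← EReal.coe_sub, EReal.coe_le_coe_iff]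
      have h3 : G - c + pairing p x₀ ≤ pairing p x - s := by linarith
      exact_mod_cast h3
  refine ⟨p, le_trans ?_ (EReal.sub_le_sub hconc (convexConj_le_of_subgradient hp))⟩
  rw [← EReal.coe_sub, EReal.coe_le_coe_iff]
  have : G - F + t ≤ G - c + pairing p x₀ - (pairing p x₀ - k₀) := by linarith
  exact_mod_cast this

theorem exists_int_ge {a : EReal} (ha : a ≠ ⊤) : ∃ k : ℤ, a ≤ ((k : ℝ) : EReal) := by
  induction a with
  | bot => exact ⟨0, bot_le⟩
  | top => exact (ha rfl).elim
  | coe r => exact ⟨⌈r⌉, EReal.coe_le_coe_iff.2 (Int.le_ceil r)⟩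

theorem exists_int_le {a : EReal} (ha : a ≠ ⊥) : ∃ k : ℤ, ((k : ℝ) : EReal) ≤ a := by
  induction a with
  | top => exact ⟨0, le_top⟩
  | bot => exact (ha rfl).elim
  | coe r => exact ⟨⌊r⌋, EReal.coe_le_coe_iff.2 (Int.floor_le r)⟩

/-- Finiteness of the dual value yields a common point of the effective domains and a lower bound
of the primal problem. -/
theorem primal_finite_of_dual_finite {f Ψ : (Fin n → ℤ) → EReal} (hf : IntegrallyConvex f)
    (hi : IntOrTop f) (hfd : (effDom f).Nonempty) (hΨ : IntSeparableConcave Ψ)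
    (hΨd : (effDom Ψ).Nonempty)
    (hfin : IsFin (⨆ p : Fin n → ℤ, (concaveConj Ψ p - convexConj f p))) :
    (∃ b : ℤ, ∀ x, ((b : ℝ) : EReal) ≤ f x - Ψ x) ∧ ∃ x, f x - Ψ x ≠ ⊤ := by
  obtain ⟨q, hq⟩ : ∃ q, concaveConj Ψ q - convexConj f q ≠ ⊥ := by
    by_contra! h
    exact hfin.1 (iSup_eq_bot.2 h)
  obtain ⟨F, hF⟩ : ∃ F : ℤ, convexConj f q ≤ ((F : ℝ) : EReal) := exists_int_ge fun h => by
    rw [h, EReal.sub_top] at hq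
    exact hq rfl
  obtain ⟨G, hG⟩ : ∃ G : ℤ, ((G : ℝ) : EReal) ≤ concaveConj Ψ q := exists_int_le fun h => by
    rw [h, EReal.bot_sub] at hq
    exact hq rfl
  refine ⟨⟨G - F, fun x => ?_⟩, ?_⟩
  · rcases hΨ.intOrBot x with h | ⟨c, hc⟩ <;> rcases hi x with h' | ⟨k, hk⟩
    · rw [h, h']; exact le_top
    · rw [h, hk, EReal.coe_sub_bot]; exact le_top
    · rw [hc, h', EReal.top_sub_coe]; exact le_top
    · have h1 := (EReal.sub_le_sub hG hF).trans (concaveConj_sub_convexConj_le hk hc q)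
      rw [hk, hc, Int.cast_sub, EReal.coe_sub]
      rwa [Int.cast_sub, EReal.coe_sub] at h1
  · by_contra! htop
    have hdisj : Disjoint (effDom f) (effDom Ψ) := by
      refine Set.disjoint_left.2 fun x hx hx' => ?_
      obtain ⟨k, hk⟩ := (hi x).resolve_left hx.2.ne
      obtain ⟨c, hc⟩ := hΨ.intOrBot.mem_effDom_iff.1 hx'
      have := htop x
      rw [hk, hc, ← EReal.coe_sub] at this
      exact EReal.coe_ne_top _ this
    obtain ⟨M, hM⟩ := exists_int_ge hfin.2
    -- This penalty forces a dual value of at least `M + 1`; truncation by `toNat` only increases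
    -- it.
    obtain ⟨p, hp⟩ := exists_dual_ge hf hi hfd hΨ hΨd hdisj hF hG (M - (G - F) + 1).toNat
    have h1 := hp.trans ((le_iSup (fun p => concaveConj Ψ p - convexConj f p) p).trans hM)
    rw [EReal.coe_le_coe_iff, Int.cast_le] at h1
    omega

end Duality

end DiscConv

theorem mainTheorem1 (n : ℕ) (f Ψ : (Fin n → ℤ) → EReal)
    (hf_int : DiscConv.IntOrTop f) (hf : DiscConv.IntegrallyConvex f)
    (hf_dom : (DiscConv.effDom f).Nonempty)
    (hΨ : DiscConv.IntSeparableConcave Ψ) (hΨ_dom : (DiscConv.effDom Ψ).Nonempty)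
    (hfin : DiscConv.IsFin (⨅ x : Fin n → ℤ, (f x - Ψ x)) ∨
      DiscConv.IsFin (⨆ p : Fin n → ℤ, (DiscConv.concaveConj Ψ p - DiscConv.convexConj f p))) :
    ∃ m : ℤ,
      IsLeast (Set.range fun x : Fin n → ℤ => f x - Ψ x) ((m : ℝ) : EReal) ∧
      IsGreatest (Set.range fun p : Fin n → ℤ =>
        DiscConv.concaveConj Ψ p - DiscConv.convexConj f p) ((m : ℝ) : EReal) := by
  have hprimal : (∃ b : ℤ, ∀ x, ((b : ℝ) : EReal) ≤ f x - Ψ x) ∧ ∃ x, f x - Ψ x ≠ ⊤ := by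
    rcases hfin with h | h
    · obtain ⟨b, hb⟩ := DiscConv.exists_int_le h.1
      refine ⟨⟨b, fun x => hb.trans (iInf_le _ x)⟩, ?_⟩
      by_contra! h'
      exact h.2 (iInf_eq_top.2 h')
    · exact DiscConv.primal_finite_of_dual_finite hf hf_int hf_dom hΨ hΨ_dom h
  obtain ⟨⟨b, hb⟩, hne⟩ := hprimal
  obtain ⟨x₀, k₀, c, hk, hc, hmin⟩ := DiscConv.exists_minimizer hf_int hΨ.intOrBot hb hne
  exact ⟨k₀ - c, DiscConv.strong_duality_of_minimizer hf hf_int hΨ hk hc hmin⟩
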